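/- Let $\mathbb X$ be a locally compact separable metric space with its Borel $\sigma$-algebra, and let $\sigma$ be a $\sigma$-finite non-atomic measure on $\mathbb X$. Let $\Omega$ be the space of configurations on $\mathbb X$, i.e. of locally finite subsets $\omega\subset\mathbb X$. Each $\omega$ is identified with the measure $\sum_{x\in\omega}\delta_x$, and $\Omega$ carries the smallest $\sigma$-algebra making all the maps $\omega\mapsto\omega(A)$, $A\subset\mathbb X$ Borel, measurable. Let $\mathbb P$ be the Poisson probability measure on $\Omega$ with intensity $\sigma$, i.e. under $\mathbb P$ the random measure $A\mapsto\omega(A)$ is a Poisson random measure with intensity measure $\sigma$; let $\mathbb E$ denote the corresponding expectation. Let $l,n_1,\dots,n_l\in\{1,2,\dots\}$ and $n=n_1+\dots+n_l$. Let $\mathcal P_n$ be the set of all partitions $P=\{P_1,\dots,P_k\}$ of $\{1,\dots,n\}$ into nonempty blocks (the number $k$ of blocks depends on $P$), and put $$P_{i,j}=\Big\{d\in P_i:\ \sum_{0<m<j}n_m<d\le\sum_{0<m\le j}n_m\Big\},\qquad 1\le i\le k,\ 1\le j\le l.$$ Let $f_0:\Omega\to[0,\infty)$ be measurable and let $f_1,\dots,f_l:\mathbb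 X\times\Omega\to[0,\infty)$ be jointly measurable. Then, as an equality in $[0,\infty]$ and with the convention $0^0=1$, $$\mathbb E\bigg[f_0(\omega)\prod_{j=1}^l\Big(\int_{\mathbb X}f_j(x;\omega)\,\omega(dx)\Big)^{n_j}\bigg] =\sum_{P\in\mathcal P_n}\mathbb E\int_{\mathbb X^k}f_0(\omega_y)\prod_{i=1}^k\prod_{j=1}^l f_j(y_i;\omega_y)^{|P_{i,j}|}\,\sigma(dy_1)\cdots\sigma(dy_k),$$ where $\omega_y=\omega\cup\{y_1,\dots,y_k\}$, which as a measure equals $\omega+\sum_{i=1}^k\delta_{y_i}$ whenever $y_1,\dots,y_k$ are distinct and not in $\omega$. -/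

import Mathlib

open MeasureTheory ProbabilityTheory
open scoped ENNReal Topology

noncomputable section

/-- A configuration on `X`: a locally finite subset of `X`. -/
@[ext]
structure Configuration (X : Type*) [TopologicalSpace X] where
  carrier : Set X
  locallyFinite : ∀ x : X, ∃ U ∈ 𝓝 x, (carrier ∩ U).Finite

namespace Configuration

/-- The measure `∑ δ_x`, summed over the points `x` of the configuration `ω`. -/
def toMeasure {X : Type*} [TopologicalSpace X] [MeasurableSpace X] (ω : Configuration X) :
    Measure X :=
  Measure.sum fun x : ω.carrier => Measure.dirac (x : X)

/-- The smallest sigma-algebra on the configuration space making all the maps `ω ↦ ω(A)`, with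
`A` a measurable subset of `X`, measurable. -/
instance instMeasurableSpace {X : Type*} [TopologicalSpace X] [MeasurableSpace X] :
    MeasurableSpace (Configuration X) :=
  ⨆ (A : Set X) (_ : MeasurableSet A),
    MeasurableSpace.comap (fun ω : Configuration X => ω.toMeasure A) (borel ℝ≥0∞)

/-- The configuration `ω ∪ {y_i : i ∈ ι}`, for a finite family `y` of points. -/
def addPoints {X : Type*} [TopologicalSpace X] {ι : Type*} [Finite ι]
    (ω : Configuration X) (y : ι → X) : Configuration X where
  carrier := ω.carrier ∪ Set.range y
  locallyFinite := by
    intro x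
    obtain ⟨U, hU, hfin⟩ := ω.locallyFinite x
    refine ⟨U, hU, (hfin.union (Set.finite_range y)).subset ?_⟩
    rintro z ⟨hz | hz, hzU⟩
    · exact Or.inl ⟨hz, hzU⟩
    · exact Or.inr hz

/-- When the added points are distinct and do not belong to `ω`, the measure of `ω.addPoints y` is
`ω + ∑ i, δ_{y i}`. -/
theorem toMeasure_addPoints {X : Type*} [TopologicalSpace X] [MeasurableSpace X]
    {ι : Type*} [Finite ι] (ω : Configuration X) (y : ι → X)
    (hy : Function.Injective y) (hω : ∀ i, y i ∉ ω.carrier) :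
    (ω.addPoints y).toMeasure = ω.toMeasure + Measure.sum fun i => Measure.dirac (y i) := by
  have hdisj : Disjoint ω.carrier (Set.range y) := by
    rw [Set.disjoint_right]
    rintro _ ⟨i, rfl⟩
    exact hω i
  ext A hA
  simp only [toMeasure, addPoints, Measure.add_apply, Measure.sum_apply _ hA]
  rw [ENNReal.summable.tsum_union_disjoint (f := fun x : X => Measure.dirac x A) hdisj
    ENNReal.summable, tsum_range (fun x : X => Measure.dirac x A) hy]

end Configuration

/-- `P` is the Poisson probability measure with intensity `σ` on the configuration space: under
`P`, the random measure `A ↦ ω(A)` is a Poisson random measure with intensity measure `σ`. -/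
structure IsPoissonProbability {X : Type*} [TopologicalSpace X] [MeasurableSpace X]
    (σ : Measure X) (P : Measure (Configuration X)) : Prop where
  isProbabilityMeasure : IsProbabilityMeasure P
  /-- `ω(A)` has the Poisson distribution with mean `σ(A)` when `σ(A) < ∞`. -/
  law : ∀ A : Set X, MeasurableSet A → σ A ≠ ∞ →
    P.map (fun ω => ω.toMeasure A) =
      (poissonMeasure (σ A).toNNReal).map (fun m : ℕ => (m : ℝ≥0∞))
  /-- `ω(A)` is almost surely infinite when `σ(A) = ∞`. -/
  eq_top : ∀ A : Set X, MeasurableSet A → σ A = ∞ → ∀ᵐ ω ∂P, ω.toMeasure A = ∞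
  /-- `ω(A_1), …, ω(A_m)` are independent for pairwise disjoint `A_1, …, A_m`. -/
  indep : ∀ (m : ℕ) (A : Fin m → Set X), (∀ i, MeasurableSet (A i)) →
    Pairwise (fun i j => Disjoint (A i) (A j)) →
    iIndepFun (fun i (ω : Configuration X) => ω.toMeasure (A i)) P

/-- For a block `B` of a partition of `{1, …, n_1 + ⋯ + n_l}`, the set of those `d ∈ B` with
`∑_{m < j} n_m < d ≤ ∑_{m ≤ j} n_m`. -/
def blockPart {l : ℕ} (n : Fin l → ℕ) (B : Finset ℕ) (j : Fin l) : Finset ℕ :=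
  B.filter fun d => ∑ m ∈ Finset.Iio j, n m < d ∧ d ≤ ∑ m ∈ Finset.Iic j, n m

end

/-!
The integral of a function with respect to a configuration `ω` is a sum over the points of `ω`, so
for each `ω` the product of the `n₁ + ⋯ + n_l` integrals is a sum over all ways to choose one point
of `ω` for each factor. Such a choice is the same as a partition of the set of factors, recording
which factors share their point, together with an injective map from the blocks to `ω`
(`Finpartition.prod_tsum_eq_sum_tsum_embedding`). The expectation of a sum over injective families
of points of `ω` is given by the multivariate Mecke equation
`IsPoissonProbability.lintegral_tsum_embedding`,
`E ∑_{y : ι ↪ ω} h(ω, y) = E ∫ h(ω ∪ y, y) σ(dy)`,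
and the theorem follows by summation over the partitions.

The multivariate Mecke equation is obtained by induction from the equation for one point,
`E ∫ g(ω, x) ω(dx) = E ∫ g(ω ∪ {x}, x) σ(dx)`
(`IsPoissonProbability.lintegral_lintegral_toMeasure`). By a π-λ argument the latter reduces to
events that depend on the numbers of points in the cells of a finite partition of the space. These
numbers are independent, which leaves the identity `E[N φ(N)] = λ E[φ(N + 1)]` for a Poisson
variable `N` of mean `λ` (`lintegral_mul_poissonMeasure`).

Measurability rests on the fact that `ω ↦ ω.toMeasure` is an s-finite kernel.
-/

/-! ### Measurability on the configuration space -/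

namespace Configuration

section Basic

variable {X : Type*} [TopologicalSpace X]

theorem finite_inter_of_isCompact (ω : Configuration X) {K : Set X} (hK : IsCompact K) :
    (ω.carrier ∩ K).Finite := by
  refine hK.induction_on (p := fun K => (ω.carrier ∩ K).Finite) (by simp) ?_ ?_ ?_
  · exact fun s t hst ht => ht.subset (Set.inter_subset_inter_right _ hst)
  · intro s t hs ht
    rw [Set.inter_union_distrib_left]
    exact hs.union ht
  · intro x _
    obtain ⟨U, hU, hfin⟩ := ω.locallyFinite x
    exact ⟨U, mem_nhdsWithin_of_mem_nhds hU, hfin⟩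

theorem countable_carrier [SigmaCompactSpace X] (ω : Configuration X) : ω.carrier.Countable := by
  have h : ω.carrier = ⋃ n, ω.carrier ∩ compactCovering X n := by
    rw [← Set.inter_iUnion, iUnion_compactCovering, Set.inter_univ]
  rw [h]
  exact Set.countable_iUnion fun n =>
    (ω.finite_inter_of_isCompact (isCompact_compactCovering X n)).countable

theorem lintegral_toMeasure [MeasurableSpace X] [MeasurableSingletonClass X]
    (ω : Configuration X) (f : X → ℝ≥0∞) :
    ∫⁻ x, f x ∂ω.toMeasure = ∑' x : ω.carrier, f x := by
  simp [toMeasure, lintegral_sum_measure]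

variable [MeasurableSpace X]

theorem toMeasure_lt_top_of_finite (ω : Configuration X) {A : Set X} (hA : MeasurableSet A)
    (h : (ω.carrier ∩ A).Finite) : ω.toMeasure A < ∞ := by
  rw [toMeasure, Measure.sum_apply _ hA]
  have hfin : {x : ω.carrier | (x : X) ∈ A}.Finite :=
    Set.Finite.of_finite_image (f := Subtype.val)
      (h.subset (by rintro _ ⟨x, hx, rfl⟩; exact ⟨x.2, hx⟩)) Subtype.val_injective.injOn
  rw [tsum_eq_sum (s := hfin.toFinset)]
  · exact ENNReal.sum_lt_top.2 fun x _ => measure_lt_top _ _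
  · intro x hx
    have : (x : X) ∉ A := by simpa using hx
    simp [Measure.dirac_apply' _ hA, this]

theorem toMeasure_singleton [MeasurableSingletonClass X] (ω : Configuration X)
    (x : X) [Decidable (x ∈ ω.carrier)] :
    ω.toMeasure {x} = if x ∈ ω.carrier then 1 else 0 := by
  rw [toMeasure, Measure.sum_apply _ (measurableSet_singleton x)]
  split_ifs with h
  · rw [tsum_eq_single ⟨x, h⟩]
    · simp
    · rintro ⟨y, hy⟩ hne
      have : y ≠ x := fun e => hne (Subtype.ext e)
      simp [this]
  · refine ENNReal.tsum_eq_zero.2 ?_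
    rintro ⟨y, hy⟩
    have : y ≠ x := fun e => h (e ▸ hy)
    simp [this]

theorem measurable_toMeasure_apply {A : Set X} (hA : MeasurableSet A) :
    Measurable fun ω : Configuration X => ω.toMeasure A := by
  refine Measurable.mono (Measurable.of_comap_le le_rfl) ?_ le_rfl
  exact le_iSup₂ (f := fun (A : Set X) (_ : MeasurableSet A) =>
    MeasurableSpace.comap (fun ω : Configuration X => ω.toMeasure A) (borel ℝ≥0∞)) A hA

theorem measurable_of_toMeasure_apply {α : Type*} [MeasurableSpace α] {g : α → Configuration X}
    (h : ∀ A, MeasurableSet A → Measurable fun a => (g a).toMeasure A) : Measurable g := by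
  rw [measurable_iff_le_map]
  refine iSup₂_le fun A hA => ?_
  rw [MeasurableSpace.comap_le_iff_le_map, MeasurableSpace.map_comp, ← measurable_iff_le_map]
  exact h A hA

/-- The kernel which sends a configuration `ω` to the measure `∑ δ_x`, summed over `x ∈ ω`. -/
noncomputable def kernel (X : Type*) [TopologicalSpace X] [MeasurableSpace X] :
    Kernel (Configuration X) X where
  toFun := toMeasure
  measurable' := Measure.measurable_of_measurable_coe _ fun _ => measurable_toMeasure_apply

theorem kernel_apply (ω : Configuration X) : kernel X ω = ω.toMeasure := rfl

end Basic

section Kernel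

variable {X : Type*} [TopologicalSpace X] [SigmaCompactSpace X] [T2Space X] [MeasurableSpace X]
  [OpensMeasurableSpace X]

/-- A configuration has finitely many points in each member of a countable compact cover, but no
uniform bound on their number; the kernel is cut into finite pieces according to the member of the
cover and to the number of points in it. -/
instance : IsSFiniteKernel (kernel X) := by
  let A : ℕ → Set X := disjointed (compactCovering X)
  have hA : ∀ n, MeasurableSet (A n) :=
    MeasurableSet.disjointed fun n => (isCompact_compactCovering X n).measurableSet
  have hfin : ∀ n (ω : Configuration X), ω.toMeasure (A n) < ∞ := fun n ω =>
    ω.toMeasure_lt_top_of_finite (hA n)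
      ((ω.finite_inter_of_isCompact (isCompact_compactCovering X n)).subset
        (Set.inter_subset_inter_right _ (disjointed_subset _ _)))
  let E : ℕ → ℕ → Set (Configuration X) := fun n m =>
    {ω | ω.toMeasure (A n) ∈ Set.Ico (m : ℝ≥0∞) (m + 1)}
  have hE : ∀ n m, MeasurableSet (E n m) := fun n m =>
    measurable_toMeasure_apply (hA n) measurableSet_Ico
  let κ : ℕ × ℕ → Kernel (Configuration X) X := fun p =>
    Kernel.piecewise (hE p.1 p.2) ((kernel X).restrict (hA p.1)) 0
  have hκ : ∀ p, IsFiniteKernel (κ p) := fun p => by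
    refine ⟨p.2 + 1, by finiteness, fun ω => ?_⟩
    simp only [κ, Kernel.piecewise_apply]
    split_ifs with h
    · rw [Kernel.restrict_apply, Measure.restrict_apply_univ, kernel_apply]
      exact h.2.le
    · simp
  have hsum : kernel X = Kernel.sum κ := by
    ext ω B hB
    rw [Kernel.sum_apply' _ _ hB, ENNReal.tsum_prod']
    have h1 : ∀ n, ∑' m, κ (n, m) ω B = kernel X ω (B ∩ A n) := by
      intro n
      -- the only contribution comes from the number `m` of points in the member of the cover
      have hne := (hfin n ω).ne
      obtain ⟨r, hr⟩ : ∃ r : NNReal, ω.toMeasure (A n) = r := ⟨_, (ENNReal.coe_toNNReal hne).symm⟩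
      rw [tsum_eq_single ⌊r⌋₊]
      · have : ω ∈ E n ⌊r⌋₊ := by
          simp only [E, Set.mem_ofPred_eq, hr, Set.mem_Ico]
          constructor
          · exact_mod_cast Nat.floor_le r.2
          · exact_mod_cast Nat.lt_floor_add_one r
        simp [κ, Kernel.piecewise_apply, this, Kernel.restrict_apply, Measure.restrict_apply hB]
      · intro m hm
        have : ω ∉ E n m := by
          simp only [E, Set.mem_ofPred_eq, hr, Set.mem_Ico]
          rintro ⟨h1, h2⟩
          refine hm ((Nat.floor_eq_iff r.2).2 ⟨?_, ?_⟩).symm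
          · exact_mod_cast h1
          · exact_mod_cast h2
        simp [κ, Kernel.piecewise_apply, this]
    simp_rw [h1]
    rw [← measure_iUnion]
    · rw [← Set.inter_iUnion, iUnion_disjointed, iUnion_compactCovering, Set.inter_univ]
    · exact fun i j hij => ((disjoint_disjointed _ hij).inter_left' _).inter_right' _
    · exact fun n => hB.inter (hA n)
  rw [hsum]
  infer_instance

theorem measurable_lintegral_toMeasure {α : Type*} [MeasurableSpace α] {g : α × X → ℝ≥0∞}
    (hg : Measurable g) {ω : α → Configuration X} (hω : Measurable ω) :
    Measurable fun a => ∫⁻ x, g (a, x) ∂(ω a).toMeasure :=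
  Measurable.lintegral_kernel_prod_right' (κ := (kernel X).comap ω hω) hg

end Kernel

section Insert

variable {X : Type*} [TopologicalSpace X]

/-- The configuration `ω ∪ {x}`. -/
def insertPoint (ω : Configuration X) (x : X) : Configuration X :=
  ω.addPoints fun _ : Unit => x

theorem carrier_insertPoint (ω : Configuration X) (x : X) :
    (ω.insertPoint x).carrier = insert x ω.carrier := by
  simp [insertPoint, addPoints]

theorem toMeasure_insertPoint_of_notMem [MeasurableSpace X] {ω : Configuration X} {x : X}
    (h : x ∉ ω.carrier) : (ω.insertPoint x).toMeasure = ω.toMeasure + Measure.dirac x := by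
  rw [insertPoint, toMeasure_addPoints _ _ (Function.injective_of_subsingleton _) fun _ => h,
    Measure.sum_fintype]
  simp

theorem insertPoint_of_mem {ω : Configuration X} {x : X} (h : x ∈ ω.carrier) :
    ω.insertPoint x = ω := by
  ext1
  rw [carrier_insertPoint, Set.insert_eq_of_mem h]

theorem addPoints_cons {k : ℕ} (ω : Configuration X) (x : X) (y : Fin k → X) :
    ω.addPoints (Fin.cons x y : Fin (k + 1) → X) = (ω.addPoints y).insertPoint x := by
  ext1
  rw [carrier_insertPoint]
  simp only [addPoints, Fin.range_cons]
  rw [Set.union_insert]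

theorem insertPoint_addPoints {k : ℕ} (ω : Configuration X) (x : X) (y : Fin k → X) :
    (ω.insertPoint x).addPoints y = (ω.addPoints y).insertPoint x := by
  ext1
  simp only [carrier_insertPoint, addPoints]
  rw [Set.insert_union]

theorem addPoints_comp_equiv {ι κ : Type*} [Finite ι] [Finite κ] (ω : Configuration X) (e : κ ≃ ι)
    (y : ι → X) : ω.addPoints (y ∘ e) = ω.addPoints y := by
  ext1
  simp only [addPoints]
  rw [e.surjective.range_comp]

variable [SigmaCompactSpace X] [T2Space X] [SecondCountableTopology X] [MeasurableSpace X]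
  [OpensMeasurableSpace X]

/-- Membership is measurable because `x ∈ ω` means `ω({x}) = 1`, which is a kernel applied to the
fibres of the diagonal. -/
theorem measurableSet_mem_carrier :
    MeasurableSet {p : Configuration X × X | p.2 ∈ p.1.carrier} := by
  classical
  have h : Measurable fun p : Configuration X × X => p.1.toMeasure {p.2} := by
    have h1 : MeasurableSet {q : (Configuration X × X) × X | q.2 = q.1.2} :=
      (isClosed_eq continuous_fst continuous_snd).measurableSet.preimage
        (f := fun q : (Configuration X × X) × X => (q.2, q.1.2)) (by fun_prop)
    have hm := measurable_lintegral_toMeasure (measurable_one.indicator h1)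
      (measurable_fst : Measurable (Prod.fst : Configuration X × X → _))
    convert hm using 2 with p
    rw [← lintegral_indicator_one (measurableSet_singleton p.2)]
    rfl
  have h2 : {p : Configuration X × X | p.2 ∈ p.1.carrier}
      = (fun p : Configuration X × X => p.1.toMeasure {p.2}) ⁻¹' {1} := by
    ext p
    by_cases hp : p.2 ∈ p.1.carrier <;> simp [toMeasure_singleton, hp]
  rw [h2]
  exact h (measurableSet_singleton 1)

theorem measurable_insertPoint :
    Measurable fun p : Configuration X × X => p.1.insertPoint p.2 := by
  classical
  refine measurable_of_toMeasure_apply fun A hA => ?_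
  have h : (fun p : Configuration X × X => (p.1.insertPoint p.2).toMeasure A) =
      fun p => if p.2 ∈ p.1.carrier then p.1.toMeasure A
        else p.1.toMeasure A + A.indicator 1 p.2 := by
    funext p
    split_ifs with hp
    · rw [insertPoint_of_mem hp]
    · rw [toMeasure_insertPoint_of_notMem hp, Measure.add_apply, Measure.dirac_apply' _ hA]
  rw [h]
  have h1 := (measurable_toMeasure_apply hA).comp
    (measurable_fst : Measurable (Prod.fst : Configuration X × X → _))
  exact Measurable.ite measurableSet_mem_carrier h1
    (h1.add ((measurable_one.indicator hA).comp measurable_snd))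

theorem measurable_addPoints_fin (k : ℕ) :
    Measurable fun p : Configuration X × (Fin k → X) => p.1.addPoints p.2 := by
  induction k with
  | zero =>
    have h : (fun p : Configuration X × (Fin 0 → X) => p.1.addPoints p.2) = Prod.fst := by
      funext p
      ext1
      simp [addPoints]
    rw [h]
    exact measurable_fst
  | succ k ih =>
    have h : (fun p : Configuration X × (Fin (k + 1) → X) => p.1.addPoints p.2) =
        fun p => (p.1.addPoints (Fin.tail p.2)).insertPoint (p.2 0) := by
      funext p
      rw [← addPoints_cons, Fin.cons_self_tail]
    rw [h]
    refine measurable_insertPoint.comp ((ih.comp (measurable_fst.prodMk ?_)).prodMk (by fun_prop))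
    exact measurable_pi_lambda _ fun i => (measurable_pi_apply i.succ).comp measurable_snd

end Insert

end Configuration

/-! ### The Mecke equation for Poisson counts -/

theorem lintegral_poissonMeasure (r : NNReal) (f : ℕ → ℝ≥0∞) :
    ∫⁻ m, f m ∂poissonMeasure r =
      ∑' m : ℕ, ENNReal.ofReal (Real.exp (-r) * r ^ m / m.factorial) * f m := by
  simp [poissonMeasure, lintegral_sum_measure, lintegral_smul_measure]

/-- The one-dimensional Mecke equation, which characterizes the Poisson distribution. -/
theorem lintegral_mul_poissonMeasure (r : NNReal) (f : ℕ → ℝ≥0∞) :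
    ∫⁻ m : ℕ, m * f m ∂poissonMeasure r = r * ∫⁻ m, f (m + 1) ∂poissonMeasure r := by
  rw [lintegral_poissonMeasure, lintegral_poissonMeasure, tsum_eq_zero_add' ENNReal.summable,
    ← ENNReal.tsum_mul_left]
  simp only [Nat.cast_zero, zero_mul, mul_zero, zero_add]
  congr 1 with m
  rw [← mul_assoc, ← mul_assoc]
  congr 1
  rw [← ENNReal.ofReal_coe_nnreal, ← ENNReal.ofReal_natCast, ← ENNReal.ofReal_mul (by positivity),
    ← ENNReal.ofReal_mul (by positivity)]
  congr 1
  rw [Nat.factorial_succ]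
  push_cast
  field_simp
  ring

/-- If one of finitely many independent variables satisfies the one-dimensional Mecke equation,
then so does the whole family, in the direction of that variable. By independence the equation
holds for measurable rectangles, and these determine a finite measure. -/
theorem lintegral_mul_indicator_of_iIndepFun {Ω ι : Type*} [MeasurableSpace Ω] [Fintype ι]
    [DecidableEq ι] {P : Measure Ω} {N : ι → Ω → ℝ≥0∞} (hN : ∀ i, Measurable (N i))
    (hind : iIndepFun N P) (i₀ : ι) {c : ℝ≥0∞} (hc : c ≠ ∞)
    (h : ∀ f : ℝ≥0∞ → ℝ≥0∞, Measurable f →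
      ∫⁻ ω, N i₀ ω * f (N i₀ ω) ∂P = c * ∫⁻ ω, f (N i₀ ω + 1) ∂P)
    {D : Set (ι → ℝ≥0∞)} (hD : MeasurableSet D) :
    ∫⁻ ω, N i₀ ω * D.indicator 1 (fun i => N i ω) ∂P =
      c * ∫⁻ ω, D.indicator 1 ((fun i => N i ω) + Pi.single i₀ 1) ∂P := by
  have := hind.isProbabilityMeasure
  have hm : Measurable fun ω i => N i ω := measurable_pi_lambda _ hN
  have hm' : Measurable fun ω => (fun i => N i ω) + (Pi.single i₀ 1 : ι → ℝ≥0∞) :=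
    measurable_pi_lambda _ fun i => (hN i).add_const _
  let ν₁ : Measure (ι → ℝ≥0∞) := (P.withDensity (N i₀)).map fun ω i => N i ω
  let ν₂ : Measure (ι → ℝ≥0∞) := c • P.map fun ω => (fun i => N i ω) + Pi.single i₀ 1
  have e₁ : ∀ D, MeasurableSet D → ν₁ D = ∫⁻ ω, N i₀ ω * D.indicator 1 (fun i => N i ω) ∂P := by
    intro D hD
    have h1 : Measurable fun ω => D.indicator (1 : (ι → ℝ≥0∞) → ℝ≥0∞) (fun i => N i ω) :=
      (measurable_one.indicator hD).comp hm
    rw [← lintegral_indicator_one hD, lintegral_map (measurable_one.indicator hD) hm,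
      lintegral_withDensity_eq_lintegral_mul _ (hN i₀) h1]
    rfl
  have e₂ : ∀ D, MeasurableSet D → ν₂ D =
      c * ∫⁻ ω, D.indicator 1 ((fun i => N i ω) + Pi.single i₀ 1) ∂P := by
    intro D hD
    rw [← lintegral_indicator_one hD, lintegral_smul_measure,
      lintegral_map (measurable_one.indicator hD) hm', smul_eq_mul]
  have hrect : ∀ s : ι → Set ℝ≥0∞, (∀ i, MeasurableSet (s i)) →
      ν₁ (Set.univ.pi s) = ν₂ (Set.univ.pi s) := by
    intro s hs
    have hS := MeasurableSet.univ_pi hs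
    have hsm : ∀ i, Measurable ((s i).indicator (1 : ℝ≥0∞ → ℝ≥0∞)) :=
      fun i => measurable_one.indicator (hs i)
    have hpi : ∀ z : ι → ℝ≥0∞, (Set.univ.pi s).indicator (1 : (ι → ℝ≥0∞) → ℝ≥0∞) z =
        ∏ i, (s i).indicator (1 : ℝ≥0∞ → ℝ≥0∞) (z i) := by
      intro z
      by_cases hz : z ∈ Set.univ.pi s
      · rw [Set.indicator_of_mem hz]
        refine (Finset.prod_eq_one fun i _ => ?_).symm
        rw [Set.indicator_of_mem (hz i (Set.mem_univ i))]
        rfl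
      · rw [Set.indicator_of_notMem hz]
        obtain ⟨i, hi⟩ : ∃ i, z i ∉ s i := by simpa using hz
        exact (Finset.prod_eq_zero (Finset.mem_univ i) (Set.indicator_of_notMem hi _)).symm
    rw [e₁ _ hS, e₂ _ hS]
    simp_rw [hpi]
    -- both sides are expectations of products of functions of one variable each
    let F : ι → ℝ≥0∞ → ℝ≥0∞ := fun i z =>
      if i = i₀ then z * (s i).indicator 1 z else (s i).indicator 1 z
    let G : ι → ℝ≥0∞ → ℝ≥0∞ := fun i z =>
      (s i).indicator 1 (z + Pi.single (M := fun _ => ℝ≥0∞) i₀ 1 i)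
    have hF : ∀ i, Measurable (F i) := fun i => by
      by_cases hi : i = i₀
      · have h0 : Measurable fun z => z * (s i₀).indicator (1 : ℝ≥0∞ → ℝ≥0∞) z :=
          measurable_id.mul (hsm i₀)
        simpa [F, hi] using h0
      · simpa [F, hi] using hsm i
    have hG : ∀ i, Measurable (G i) := fun i => (hsm i).comp (measurable_id.add_const _)
    have hF' : ∀ ω, N i₀ ω * ∏ i, (s i).indicator 1 (N i ω) = ∏ i, F i (N i ω) := by
      intro ω
      rw [← Finset.mul_prod_erase _ _ (Finset.mem_univ i₀),
        ← Finset.mul_prod_erase _ _ (Finset.mem_univ i₀), ← mul_assoc]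
      congr 1
      · simp [F]
      · refine Finset.prod_congr rfl fun i hi => ?_
        simp [F, Finset.ne_of_mem_erase hi]
    simp_rw [hF']
    rw [lintegral_prod_eq_prod_lintegral_of_indepFun Finset.univ (fun i ω => F i (N i ω))
      (hind.comp F hF) fun i => (hF i).comp (hN i)]
    refine Eq.trans ?_ (congrArg (c * ·)
      (lintegral_prod_eq_prod_lintegral_of_indepFun Finset.univ (fun i ω => G i (N i ω))
        (hind.comp G hG) fun i => (hG i).comp (hN i)).symm)
    rw [← Finset.mul_prod_erase _ _ (Finset.mem_univ i₀)]
    rw [← Finset.mul_prod_erase _ _ (Finset.mem_univ i₀), ← mul_assoc]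
    congr 1
    · simpa [F, G] using h _ (hsm i₀)
    · refine Finset.prod_congr rfl fun i hi => ?_
      simp [F, G, Finset.ne_of_mem_erase hi]
  have huniv : ν₁ Set.univ = ν₂ Set.univ := by
    have := hrect (fun _ => Set.univ) fun _ => MeasurableSet.univ
    rwa [Set.pi_univ] at this
  have : IsFiniteMeasure ν₁ := by
    refine ⟨?_⟩
    rw [huniv, e₂ _ MeasurableSet.univ]
    simpa using hc.lt_top
  have hν : ν₁ = ν₂ := by
    refine ext_of_generate_finite _ generateFrom_pi.symm isPiSystem_pi ?_ huniv
    rintro _ ⟨s, hs, rfl⟩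
    exact hrect s fun i => hs i (Set.mem_univ i)
  rw [← e₁ D hD, ← e₂ D hD, hν]

namespace IsPoissonProbability

variable {X : Type*} [TopologicalSpace X] [MeasurableSpace X]
  {σ : Measure X} {P : Measure (Configuration X)}

theorem lintegral_toMeasure_mul (hP : IsPoissonProbability σ P) {A : Set X}
    (hA : MeasurableSet A) (hσ : σ A ≠ ∞) {f : ℝ≥0∞ → ℝ≥0∞} (hf : Measurable f) :
    ∫⁻ ω, ω.toMeasure A * f (ω.toMeasure A) ∂P = σ A * ∫⁻ ω, f (ω.toMeasure A + 1) ∂P := by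
  have hm := Configuration.measurable_toMeasure_apply hA
  have hf₁ : Measurable fun z => z * f z := measurable_id.mul hf
  have hf₂ : Measurable fun z => f (z + 1) := hf.comp (measurable_id.add_const 1)
  rw [← lintegral_map (f := fun z => z * f z) (g := fun ω : Configuration X => ω.toMeasure A)
      hf₁ hm,
    ← lintegral_map (f := fun z => f (z + 1)) (g := fun ω : Configuration X => ω.toMeasure A)
      hf₂ hm, hP.law A hA hσ,
    lintegral_map hf₁ .of_discrete,
    lintegral_map hf₂ .of_discrete,
    lintegral_mul_poissonMeasure, ENNReal.coe_toNNReal hσ]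
  simp

theorem iIndepFun_toMeasure (hP : IsPoissonProbability σ P) {ι : Type*} [Fintype ι]
    {A : ι → Set X} (hA : ∀ i, MeasurableSet (A i))
    (hd : Pairwise fun i j => Disjoint (A i) (A j)) :
    iIndepFun (fun i (ω : Configuration X) => ω.toMeasure (A i)) P := by
  let e := Fintype.equivFin ι
  have h := (hP.indep _ (A ∘ e.symm) (fun i => hA _)
    fun i j hij => hd (e.symm.injective.ne hij)).precomp e.injective
  simpa using h

end IsPoissonProbability

/-! ### The Mecke equation -/

namespace IsPoissonProbability

open Configuration

variable {X : Type*} [TopologicalSpace X] [SigmaCompactSpace X] [MeasurableSpace X]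
  {σ : Measure X} [NullSingletonClass σ] {P : Measure (Configuration X)}

/-- The Mecke equation on a cell `τ ⁻¹' {i₀}` of a finite partition of the space, for events that
depend only on the numbers of points in the cells. -/
theorem lintegral_cell (hP : IsPoissonProbability σ P) {ι : Type*} [Fintype ι]
    [MeasurableSpace ι] [MeasurableSingletonClass ι] {τ : X → ι} (hτ : Measurable τ) (i₀ : ι)
    (hσ : σ (τ ⁻¹' {i₀}) ≠ ∞) {D : Set (ι → ℝ≥0∞)} (hD : MeasurableSet D) :
    ∫⁻ ω, ω.toMeasure (τ ⁻¹' {i₀}) *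
        D.indicator 1 (fun i => ω.toMeasure (τ ⁻¹' {i})) ∂P =
      ∫⁻ ω, ∫⁻ x in τ ⁻¹' {i₀},
        D.indicator 1 (fun i => (ω.insertPoint x).toMeasure (τ ⁻¹' {i})) ∂σ ∂P := by
  classical
  have hm : ∀ i, MeasurableSet (τ ⁻¹' {i}) := fun i => hτ (measurableSet_singleton i)
  have hind := hP.iIndepFun_toMeasure hm fun i j hij =>
    Disjoint.preimage τ (Set.disjoint_singleton.2 hij)
  rw [lintegral_mul_indicator_of_iIndepFun (fun i => measurable_toMeasure_apply (hm i)) hind i₀ hσ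
    (fun f hf => hP.lintegral_toMeasure_mul (hm i₀) hσ hf) hD, ← lintegral_const_mul' _ _ hσ]
  refine lintegral_congr fun ω => ?_
  rw [mul_comm, ← setLIntegral_const]
  refine lintegral_congr_ae ?_
  -- as `σ` has no atoms, almost every `x` is a new point and adds one to the count of its cell
  filter_upwards [ae_restrict_mem (hm i₀),
    ae_restrict_of_ae (ω.countable_carrier.ae_notMem σ)] with x hx hxω
  congr 1
  funext i
  rw [toMeasure_insertPoint_of_notMem hxω, Measure.add_apply, Measure.dirac_apply' _ (hm i),
    Pi.add_apply]
  congr 1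
  by_cases hi : i = i₀
  · subst hi
    rw [Pi.single_eq_same, Set.indicator_of_mem hx]
    rfl
  · rw [Pi.single_eq_of_ne hi, Set.indicator_of_notMem]
    intro hx'
    exact hi (hx'.symm.trans hx)

variable [T2Space X] [SecondCountableTopology X] [OpensMeasurableSpace X] [SigmaFinite σ]

/-- The Mecke equation for a product `Γ × A` with `A` of finite intensity. Both sides are finite
measures in `Γ`, so it suffices to treat the events `{ω | ∀ B ∈ t, ω(B) ∈ D_B}` with `t` finite;
these depend on the numbers of points in the atoms of the partition generated by `A` and `t`. -/
theorem lintegral_toMeasure_mul_indicator (hP : IsPoissonProbability σ P) {A : Set X}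
    (hA : MeasurableSet A) (hσ : σ A ≠ ∞) {Γ : Set (Configuration X)} (hΓ : MeasurableSet Γ) :
    ∫⁻ ω, ω.toMeasure A * Γ.indicator 1 ω ∂P =
      ∫⁻ ω, ∫⁻ x in A, Γ.indicator 1 (ω.insertPoint x) ∂σ ∂P := by
  classical
  have := hP.isProbabilityMeasure
  let ν₁ : Measure (Configuration X) := P.withDensity fun ω => ω.toMeasure A
  let ν₂ : Measure (Configuration X) :=
    (P.prod (σ.restrict A)).map fun p => p.1.insertPoint p.2
  have e₁ : ∀ Γ, MeasurableSet Γ → ν₁ Γ = ∫⁻ ω, ω.toMeasure A * Γ.indicator 1 ω ∂P := by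
    intro Γ hΓ
    rw [← lintegral_indicator_one hΓ,
      lintegral_withDensity_eq_lintegral_mul _ (measurable_toMeasure_apply hA)
        (measurable_one.indicator hΓ)]
    rfl
  have e₂ : ∀ Γ, MeasurableSet Γ → ν₂ Γ =
      ∫⁻ ω, ∫⁻ x in A, Γ.indicator 1 (ω.insertPoint x) ∂σ ∂P := by
    intro Γ hΓ
    rw [← lintegral_indicator_one hΓ,
      lintegral_map (measurable_one.indicator hΓ) measurable_insertPoint]
    exact lintegral_prod _ ((measurable_one.indicator hΓ).comp measurable_insertPoint).aemeasurable
  have huniv : ν₁ Set.univ = σ A := by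
    rw [e₁ _ MeasurableSet.univ]
    simpa using hP.lintegral_toMeasure_mul hA hσ (f := fun _ => 1) measurable_const
  have hfin : IsFiniteMeasure ν₁ := ⟨by rw [huniv]; exact hσ.lt_top⟩
  have huniv' : ν₂ Set.univ = σ A := by
    rw [e₂ _ MeasurableSet.univ]
    simp
  -- the σ-algebra of `Configuration X` is by definition the supremum of these
  let m : Set X → MeasurableSpace (Configuration X) := fun A =>
    MeasurableSpace.comap (fun ω : Configuration X => ω.toMeasure A) (borel ℝ≥0∞)
  have hν : ν₁ = ν₂ := by
    refine ext_of_generate_finite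
      (piiUnionInter (fun B => {s | MeasurableSet[m B] s}) {B | MeasurableSet B})
      (generateFrom_piiUnionInter_measurableSet m _).symm
      (isPiSystem_piiUnionInter _ (fun B => (m B).isPiSystem_measurableSet) _) ?_
      (huniv.trans huniv'.symm)
    rintro _ ⟨t, ht, g, hg, rfl⟩
    choose! E hE hEg using hg
    -- `τ x` records to which of the sets in `insert A t` the point `x` belongs
    let T : Finset (Set X) := insert A t
    have hT : ∀ B ∈ T, MeasurableSet B := by
      intro B hB
      rcases Finset.mem_insert.1 hB with rfl | hB
      exacts [hA, ht hB]
    let τ : X → (T → Prop) := fun x B => x ∈ (B : Set X)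
    have hτ : Measurable τ := measurable_pi_lambda _ fun B => (hT B B.2).mem
    let S : T → Finset (T → Prop) := fun B => Finset.univ.filter fun i => i B
    have hS : ∀ B : T, τ ⁻¹' (S B : Set (T → Prop)) = B := by
      intro B
      ext x
      simp [S, τ]
    have hcount : ∀ (B : T) (μ : Measure X), μ B = ∑ i ∈ S B, μ (τ ⁻¹' {i}) := by
      intro B μ
      rw [sum_measure_preimage_singleton _ fun i _ => hτ (measurableSet_singleton i), hS]
    -- the event in terms of the numbers of points in the atoms
    let D : Set ((T → Prop) → ℝ≥0∞) := ⋂ B : T,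
      if (B : Set X) ∈ t then (fun z => ∑ i ∈ S B, z i) ⁻¹' E B else Set.univ
    have hD : MeasurableSet D := by
      refine MeasurableSet.iInter fun B => ?_
      split_ifs with hB
      · have hz : Measurable fun z : (T → Prop) → ℝ≥0∞ => ∑ i ∈ S B, z i := by fun_prop
        exact hz (hE B hB)
      · exact MeasurableSet.univ
    have hΓ : (⋂ B ∈ t, g B) =
        (fun (ω : Configuration X) i => ω.toMeasure (τ ⁻¹' {i})) ⁻¹' D := by
      ext ω
      simp only [Set.mem_iInter, D, Set.mem_preimage]
      constructor
      · intro h B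
        split_ifs with hB
        · have := h B hB
          rw [← hEg B hB] at this
          rw [Set.mem_preimage, ← hcount]
          exact this
        · trivial
      · intro h B hB
        have := h ⟨B, Finset.mem_insert_of_mem hB⟩
        rw [if_pos hB, Set.mem_preimage, ← hcount] at this
        rw [← hEg B hB]
        exact this
    have hN : Measurable fun (ω : Configuration X) (i : T → Prop) => ω.toMeasure (τ ⁻¹' {i}) :=
      measurable_pi_lambda _ fun i => measurable_toMeasure_apply (hτ (measurableSet_singleton i))
    have hΓm : MeasurableSet (⋂ B ∈ t, g B) := hΓ ▸ hN hD
    rw [e₁ _ hΓm, e₂ _ hΓm, hΓ]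
    let A' : T := ⟨A, Finset.mem_insert_self _ _⟩
    have hAu : A = ⋃ i ∈ S A', τ ⁻¹' {i} := by
      ext x
      simp [S, τ, A']
    have hle : ∀ i ∈ S A', σ (τ ⁻¹' {i}) ≠ ∞ := fun i hi =>
      ne_top_of_le_ne_top hσ (measure_mono (by
        conv_rhs => rw [hAu]
        exact Set.subset_biUnion_of_mem (u := fun i => τ ⁻¹' {i}) hi))
    have hind : ∀ ω : Configuration X,
        ((fun (ω : Configuration X) i => ω.toMeasure (τ ⁻¹' {i})) ⁻¹' D).indicator
          (1 : Configuration X → ℝ≥0∞) ω = D.indicator 1 fun i => ω.toMeasure (τ ⁻¹' {i}) :=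
      fun ω => rfl
    simp_rw [hind]
    have hDm : Measurable fun ω : Configuration X =>
        D.indicator (1 : ((T → Prop) → ℝ≥0∞) → ℝ≥0∞) fun i => ω.toMeasure (τ ⁻¹' {i}) :=
      (measurable_one.indicator hD).comp hN
    have hl : ∀ ω : Configuration X, ω.toMeasure A = ∑ i ∈ S A', ω.toMeasure (τ ⁻¹' {i}) :=
      fun ω => hcount A' _
    have hr : ∀ ω : Configuration X,
        ∫⁻ x in A, D.indicator 1 (fun i => (ω.insertPoint x).toMeasure (τ ⁻¹' {i})) ∂σ =
        ∑ i₀ ∈ S A', ∫⁻ x in τ ⁻¹' {i₀},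
          D.indicator 1 (fun i => (ω.insertPoint x).toMeasure (τ ⁻¹' {i})) ∂σ := by
      intro ω
      conv_lhs => rw [hAu]
      exact lintegral_biUnion_finset
        (fun i _ j _ hij => Disjoint.preimage τ (Set.disjoint_singleton.2 hij))
        (fun i _ => hτ (measurableSet_singleton i)) _
    simp_rw [hl, hr, Finset.sum_mul]
    refine (lintegral_finsetSum _ fun i _ =>
        (measurable_toMeasure_apply (hτ (measurableSet_singleton i))).mul hDm).trans
      (Eq.trans ?_ (lintegral_finsetSum _ fun i _ =>
        (hDm.comp measurable_insertPoint).lintegral_prod_right').symm)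
    exact Finset.sum_congr rfl fun i hi => hP.lintegral_cell hτ i (hle i hi) hD
  rw [← e₁ Γ hΓ, ← e₂ Γ hΓ, hν]

/-- The Mecke equation. The two sides define measures on `Configuration X × X` which agree and are
finite on the products `Γ × A` with `σ A < ∞`; these generate the σ-algebra and countably many of
them cover the space. -/
theorem lintegral_lintegral_toMeasure (hP : IsPoissonProbability σ P)
    {g : Configuration X × X → ℝ≥0∞} (hg : Measurable g) :
    ∫⁻ ω, ∫⁻ x, g (ω, x) ∂ω.toMeasure ∂P =
      ∫⁻ ω, ∫⁻ x, g (ω.insertPoint x, x) ∂σ ∂P := by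
  have := hP.isProbabilityMeasure
  have hmap : Measurable fun p : Configuration X × X => (p.1.insertPoint p.2, p.2) :=
    measurable_insertPoint.prodMk measurable_snd
  let D : Set (Set X) := {A | MeasurableSet A ∧ σ A ≠ ∞}
  have hspan : ∀ n, spanningSets σ n ∈ D := fun n =>
    ⟨measurableSet_spanningSets σ n, (measure_spanningSets_lt_top σ n).ne⟩
  have hgen : MeasurableSpace.generateFrom D = ‹MeasurableSpace X› := by
    refine le_antisymm (MeasurableSpace.generateFrom_le fun A hA => hA.1) fun A hA => ?_
    have h : A = ⋃ n, A ∩ spanningSets σ n := by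
      rw [← Set.inter_iUnion, iUnion_spanningSets, Set.inter_univ]
    rw [h]
    exact MeasurableSet.iUnion fun n => MeasurableSpace.measurableSet_generateFrom
      ⟨hA.inter (hspan n).1, ne_top_of_le_ne_top (hspan n).2 (measure_mono Set.inter_subset_right)⟩
  have hrect : ∀ Γ A, MeasurableSet Γ → A ∈ D →
      (P ⊗ₘ kernel X) (Γ ×ˢ A) =
        (P.prod σ).map (fun p => (p.1.insertPoint p.2, p.2)) (Γ ×ˢ A) := by
    intro Γ A hΓ hA
    have hi : Measurable ((Γ ×ˢ A).indicator (1 : Configuration X × X → ℝ≥0∞)) :=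
      measurable_one.indicator (hΓ.prod hA.1)
    rw [Measure.compProd_apply_prod hΓ hA.1, ← lintegral_indicator_one (hΓ.prod hA.1),
      lintegral_map hi hmap]
    refine Eq.trans ?_ (lintegral_prod _ (hi.comp hmap).aemeasurable).symm
    have h := hP.lintegral_toMeasure_mul_indicator hA.1 hA.2 hΓ
    refine Eq.trans ?_ (h.trans ?_)
    · rw [← lintegral_indicator hΓ]
      refine lintegral_congr fun ω => ?_
      by_cases hω : ω ∈ Γ <;> simp [hω, kernel_apply]
    · refine lintegral_congr fun ω => ?_
      rw [← lintegral_indicator hA.1]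
      refine lintegral_congr fun x => ?_
      by_cases hx : x ∈ A <;> by_cases hω : ω.insertPoint x ∈ Γ <;> simp [hx, hω]
  have hμ : P ⊗ₘ kernel X = (P.prod σ).map fun p => (p.1.insertPoint p.2, p.2) := by
    refine Measure.ext_of_generateFrom_of_iUnion
      (Set.image2 (· ×ˢ ·) {Γ | MeasurableSet Γ} D) (fun n => Set.univ ×ˢ spanningSets σ n)
      (generateFrom_eq_prod MeasurableSpace.generateFrom_measurableSet hgen
        isCountablySpanning_measurableSet
        ⟨spanningSets σ, hspan, iUnion_spanningSets σ⟩).symm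
      (MeasurableSpace.isPiSystem_measurableSet.prod fun A hA B hB _ =>
        ⟨hA.1.inter hB.1, ne_top_of_le_ne_top hA.2 (measure_mono Set.inter_subset_left)⟩)
      ?_ (fun n => ⟨_, MeasurableSet.univ (α := Configuration X), _, hspan n, rfl⟩) ?_ ?_
    · rw [← Set.prod_iUnion, iUnion_spanningSets, Set.univ_prod_univ]
    · intro n
      have h := hP.lintegral_toMeasure_mul (hspan n).1 (hspan n).2 (f := fun _ => 1)
        measurable_const
      rw [Measure.compProd_apply_prod MeasurableSet.univ (hspan n).1, setLIntegral_univ]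
      simp only [mul_one, lintegral_one, measure_univ] at h
      simp only [kernel_apply, h]
      exact (hspan n).2
    · rintro _ ⟨Γ, hΓ, A, hA, rfl⟩
      exact hrect Γ A hΓ hA
  have h := congrArg (fun μ : Measure (Configuration X × X) => ∫⁻ p, g p ∂μ) hμ
  rw [Measure.lintegral_compProd hg, lintegral_map hg hmap] at h
  exact h.trans (lintegral_prod _ (hg.comp hmap).aemeasurable)

end IsPoissonProbability

/-! ### The multivariate Mecke equation -/

namespace Configuration

theorem tsum_embedding_congr {X : Type*} [TopologicalSpace X] {ι κ : Type*}
    (ω : Configuration X) (e : ι ≃ κ) (h : (ι → X) → ℝ≥0∞) :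
    ∑' y : κ ↪ ω.carrier, h (fun i => y (e i)) = ∑' y : ι ↪ ω.carrier, h (fun i => y i) := by
  rw [← (e.embeddingCongr (Equiv.refl ω.carrier)).tsum_eq]
  simp

variable {X : Type*} [TopologicalSpace X] [MeasurableSpace X]

theorem lintegral_toMeasure_eq_tsum_indicator [MeasurableSingletonClass X]
    (ω : Configuration X) (f : X → ℝ≥0∞) :
    ∫⁻ x, f x ∂ω.toMeasure = ∑' x, ω.carrier.indicator f x := by
  rw [lintegral_toMeasure, tsum_subtype]

/-- Points of the family `y` that are added to `ω` do not contribute to the integral of a function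
which vanishes at them. -/
theorem lintegral_indicator_compl_range_addPoints [MeasurableSingletonClass X]
    {ι : Type*} [Finite ι] (ω : Configuration X) (y : ι → X) (f : X → ℝ≥0∞) :
    ∫⁻ x, (Set.range y)ᶜ.indicator f x ∂(ω.addPoints y).toMeasure =
      ∫⁻ x, (Set.range y)ᶜ.indicator f x ∂ω.toMeasure := by
  rw [lintegral_toMeasure_eq_tsum_indicator, lintegral_toMeasure_eq_tsum_indicator]
  congr 1
  funext x
  rw [Set.indicator_indicator, Set.indicator_indicator]
  congr 1
  simp only [addPoints, Set.union_inter_distrib_right, Set.inter_compl_self, Set.union_empty]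

/-- A tuple of `k + 1` distinct points of `ω` is a tuple of `k` distinct points together with one
more point, which is listed first; the sum over the latter is written as an integral, so that its
measurability is that of a kernel integral. -/
theorem tsum_embedding_succ [MeasurableSingletonClass X] {k : ℕ} (ω : Configuration X)
    (h : (Fin (k + 1) → X) → ℝ≥0∞) :
    ∑' y : Fin (k + 1) ↪ ω.carrier, h (fun i => y i) =
      ∑' y : Fin k ↪ ω.carrier, ∫⁻ x,
        (Set.range fun i => (y i : X))ᶜ.indicator
          (fun x => h (Fin.cons x fun i => (y i : X))) x ∂ω.toMeasure := by
  rw [← (Equiv.embeddingFinSucc k ω.carrier).symm.tsum_eq, ENNReal.tsum_sigma']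
  congr 1
  funext y
  have h1 : ∀ x : {x // x ∉ Set.range y},
      h (fun i => ((Equiv.embeddingFinSucc k ω.carrier).symm ⟨y, x⟩ i : X)) =
        h (Fin.cons (x : ω.carrier) fun i => (y i : X)) := by
    intro x
    congr 1
    obtain ⟨z, hz⟩ := (Equiv.embeddingFinSucc k ω.carrier).surjective ⟨y, x⟩
    rw [← hz, Equiv.symm_apply_apply]
    have e1 := Equiv.embeddingFinSucc_fst z
    have e2 := Equiv.embeddingFinSucc_snd z
    rw [hz] at e1 e2
    funext i
    refine Fin.cases ?_ (fun i => ?_) i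
    · simp [← e2]
    · simp only [Fin.cons_succ]
      rw [show y i = z i.succ from congrFun e1 i]
  simp_rw [h1]
  rw [lintegral_toMeasure]
  refine (tsum_subtype ((Set.range y)ᶜ) fun x : ω.carrier =>
    h (Fin.cons (x : X) fun i => (y i : X))).trans ?_
  congr 1
  funext x
  by_cases hx : x ∈ Set.range y
  · have hx' : (x : X) ∈ Set.range fun i => (y i : X) := by
      obtain ⟨i, hi⟩ := hx
      exact ⟨i, congrArg Subtype.val hi⟩
    rw [Set.indicator_of_notMem (by simpa using hx), Set.indicator_of_notMem (by simpa using hx')]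
  · have hx' : (x : X) ∉ Set.range fun i => (y i : X) := by
      rintro ⟨i, hi⟩
      exact hx ⟨i, Subtype.ext hi⟩
    rw [Set.indicator_of_mem (by simpa using hx), Set.indicator_of_mem (by simpa using hx')]

section Measurability

variable [T2Space X] [SecondCountableTopology X] [OpensMeasurableSpace X]

theorem measurable_indicator_cons {k : ℕ} {h : Configuration X × (Fin (k + 1) → X) → ℝ≥0∞}
    (hh : Measurable h) :
    Measurable fun p : (Configuration X × (Fin k → X)) × X =>
      (Set.range p.1.2)ᶜ.indicator (fun x => h (p.1.1, Fin.cons x p.1.2)) p.2 := by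
  have hs : MeasurableSet {p : (Configuration X × (Fin k → X)) × X | p.2 ∈ (Set.range p.1.2)ᶜ} := by
    have : {p : (Configuration X × (Fin k → X)) × X | p.2 ∈ (Set.range p.1.2)ᶜ} =
        (⋃ i, {p : (Configuration X × (Fin k → X)) × X | p.1.2 i = p.2})ᶜ := by
      ext p
      simp
    rw [this]
    refine (MeasurableSet.iUnion fun i => ?_).compl
    exact (isClosed_eq continuous_fst continuous_snd).measurableSet.preimage
      (f := fun p : (Configuration X × (Fin k → X)) × X => (p.1.2 i, p.2)) (by fun_prop)
  have hc : Measurable fun p : (Configuration X × (Fin k → X)) × X =>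
      (p.1.1, (Fin.cons p.2 p.1.2 : Fin (k + 1) → X)) := by
    refine measurable_fst.fst.prodMk (measurable_pi_lambda _ fun i => ?_)
    refine Fin.cases ?_ (fun i => ?_) i
    · simpa using measurable_snd
    · simp only [Fin.cons_succ]
      fun_prop
  exact (hh.comp hc).indicator hs

variable [SigmaCompactSpace X]

theorem measurable_lintegral_indicator_cons {k : ℕ}
    {h : Configuration X × (Fin (k + 1) → X) → ℝ≥0∞} (hh : Measurable h) :
    Measurable fun p : Configuration X × (Fin k → X) => ∫⁻ x,
      (Set.range p.2)ᶜ.indicator (fun x => h (p.1, Fin.cons x p.2)) x ∂p.1.toMeasure :=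
  measurable_lintegral_toMeasure (measurable_indicator_cons hh) measurable_fst

theorem measurable_tsum_embedding_fin (k : ℕ) {h : Configuration X × (Fin k → X) → ℝ≥0∞}
    (hh : Measurable h) :
    Measurable fun ω : Configuration X => ∑' y : Fin k ↪ ω.carrier, h (ω, fun i => y i) := by
  induction k with
  | zero =>
    have h0 : (fun ω : Configuration X => ∑' y : Fin 0 ↪ ω.carrier, h (ω, fun i => y i)) =
        fun ω => h (ω, Fin.elim0) := by
      funext ω
      rw [tsum_eq_single default fun y hy => (hy (Subsingleton.elim _ _)).elim]
      congr
      exact Subsingleton.elim _ _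
    rw [h0]
    exact hh.comp (measurable_id.prodMk measurable_const)
  | succ k ih =>
    simp_rw [fun ω : Configuration X => ω.tsum_embedding_succ fun y => h (ω, y)]
    exact ih (measurable_lintegral_indicator_cons hh)

theorem measurable_tsum_embedding {ι : Type*} [Fintype ι]
    {h : Configuration X × (ι → X) → ℝ≥0∞}
    (hh : Measurable h) :
    Measurable fun ω : Configuration X => ∑' y : ι ↪ ω.carrier, h (ω, fun i => y i) := by
  let e := Fintype.equivFin ι
  have he : Measurable fun p : Configuration X × (Fin (Fintype.card ι) → X) => (p.1, p.2 ∘ e) :=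
    measurable_fst.prodMk (measurable_pi_lambda _ fun i => by
      simp only [Function.comp_apply]; fun_prop)
  have := measurable_tsum_embedding_fin _ (hh.comp he)
  convert this using 2 with ω
  exact (ω.tsum_embedding_congr e fun y => h (ω, y)).symm

end Measurability

end Configuration

namespace IsPoissonProbability

open Configuration

variable {X : Type*} [TopologicalSpace X] [T2Space X] [SecondCountableTopology X]
  [SigmaCompactSpace X] [MeasurableSpace X] [OpensMeasurableSpace X]
  {σ : Measure X} [SigmaFinite σ] [NullSingletonClass σ] {P : Measure (Configuration X)}

/-- The multivariate Mecke equation, for tuples of distinct points of the configuration. In the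
inductive step, one point is split off and the Mecke equation is applied to it, the other points
being fixed; it may be assumed distinct from these because `σ` has no atoms. -/
theorem lintegral_tsum_embedding_fin (hP : IsPoissonProbability σ P) (k : ℕ)
    {h : Configuration X × (Fin k → X) → ℝ≥0∞} (hh : Measurable h) :
    ∫⁻ ω, ∑' y : Fin k ↪ ω.carrier, h (ω, fun i => y i) ∂P =
      ∫⁻ ω, ∫⁻ y, h (ω.addPoints y, y) ∂(Measure.pi fun _ => σ) ∂P := by
  have := hP.isProbabilityMeasure
  induction k with
  | zero =>
    refine lintegral_congr fun ω => ?_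
    rw [tsum_eq_single default fun y hy => (hy (Subsingleton.elim _ _)).elim,
      Measure.pi_of_empty (x := Fin.elim0), lintegral_dirac]
    congr 2
    · ext1
      simp [addPoints]
    · exact Subsingleton.elim _ _
  | succ k ih =>
    let μ : Measure (Fin k → X) := Measure.pi fun _ => σ
    let F : Configuration X × (Fin k → X) → X → ℝ≥0∞ := fun p x =>
      (Set.range p.2)ᶜ.indicator (fun x => h (p.1.addPoints p.2, Fin.cons x p.2)) x
    have hF : Measurable fun q : (Configuration X × (Fin k → X)) × X => F q.1 q.2 :=
      (measurable_indicator_cons hh).comp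
        ((((measurable_addPoints_fin k).comp measurable_fst).prodMk measurable_fst.snd).prodMk
          measurable_snd)
    have hG : Measurable fun q : (Configuration X × (Fin k → X)) × X =>
        F (q.1.1.insertPoint q.2, q.1.2) q.2 := by
      refine hF.comp (((measurable_insertPoint.comp
        (measurable_fst.fst.prodMk measurable_snd)).prodMk measurable_fst.snd).prodMk
          measurable_snd)
    have hH : Measurable fun p : Configuration X × (Fin (k + 1) → X) =>
        h (p.1.addPoints p.2, p.2) :=
      hh.comp ((measurable_addPoints_fin (k + 1)).prodMk measurable_snd)
    calc ∫⁻ ω, ∑' y : Fin (k + 1) ↪ ω.carrier, h (ω, fun i => y i) ∂P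
        = ∫⁻ ω, ∫⁻ y, ∫⁻ x, F (ω, y) x ∂ω.toMeasure ∂μ ∂P := by
          simp_rw [fun ω : Configuration X => ω.tsum_embedding_succ fun y => h (ω, y)]
          rw [ih (measurable_lintegral_indicator_cons hh)]
          refine lintegral_congr fun ω => lintegral_congr fun y => ?_
          exact lintegral_indicator_compl_range_addPoints ω y _
      _ = ∫⁻ y, ∫⁻ ω, ∫⁻ x, F (ω, y) x ∂ω.toMeasure ∂P ∂μ :=
          lintegral_lintegral_swap
            (measurable_lintegral_toMeasure hF measurable_fst).aemeasurable
      _ = ∫⁻ y, ∫⁻ ω, ∫⁻ x, F (ω.insertPoint x, y) x ∂σ ∂P ∂μ := by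
          refine lintegral_congr fun y => ?_
          exact hP.lintegral_lintegral_toMeasure (g := fun q => F (q.1, y) q.2)
            (hF.comp ((measurable_fst.prodMk measurable_const).prodMk measurable_snd))
      _ = ∫⁻ ω, ∫⁻ y, ∫⁻ x, F (ω.insertPoint x, y) x ∂σ ∂μ ∂P :=
          (lintegral_lintegral_swap hG.lintegral_prod_right'.aemeasurable).symm
      _ = ∫⁻ ω, ∫⁻ y, ∫⁻ x, h (ω.addPoints (Fin.cons x y : Fin (k + 1) → X), Fin.cons x y)
            ∂σ ∂μ ∂P := by
          refine lintegral_congr fun ω => lintegral_congr fun y => lintegral_congr_ae ?_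
          filter_upwards [(Set.finite_range y).countable.ae_notMem σ] with x hx
          simp only [F]
          rw [Set.indicator_of_mem (by simpa using hx), insertPoint_addPoints, addPoints_cons]
      _ = ∫⁻ ω, ∫⁻ y, h (ω.addPoints y, y) ∂(Measure.pi fun _ => σ) ∂P := by
          refine lintegral_congr fun ω => ?_
          have hω : Measurable fun y : Fin (k + 1) → X => h (ω.addPoints y, y) :=
            hH.comp (measurable_const.prodMk measurable_id)
          have e := (measurePreserving_piFinSuccAbove (fun _ : Fin (k + 1) => σ) 0).symm
          rw [← e.lintegral_comp hω]
          refine Eq.trans ?_ (lintegral_prod_symm _ (hω.comp e.measurable).aemeasurable).symm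
          refine lintegral_congr fun y => lintegral_congr fun x => ?_
          simp [MeasurableEquiv.piFinSuccAbove, Fin.insertNthEquiv]

theorem lintegral_tsum_embedding (hP : IsPoissonProbability σ P) {ι : Type*} [Fintype ι]
    {h : Configuration X × (ι → X) → ℝ≥0∞} (hh : Measurable h) :
    ∫⁻ ω, ∑' y : ι ↪ ω.carrier, h (ω, fun i => y i) ∂P =
      ∫⁻ ω, ∫⁻ y, h (ω.addPoints y, y) ∂(Measure.pi fun _ => σ) ∂P := by
  let e := Fintype.equivFin ι
  have he : Measurable fun p : Configuration X × (Fin (Fintype.card ι) → X) => (p.1, p.2 ∘ e) :=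
    measurable_fst.prodMk (measurable_pi_lambda _ fun i => by
      simp only [Function.comp_apply]; fun_prop)
  have hF := hP.lintegral_tsum_embedding_fin _ (hh.comp he)
  refine Eq.trans (lintegral_congr fun ω => ?_) (hF.trans (lintegral_congr fun ω => ?_))
  · exact (ω.tsum_embedding_congr e fun y => h (ω, y)).symm
  · have hp := measurePreserving_piCongrLeft (fun _ : ι => σ) e.symm
    rw [← hp.lintegral_comp_emb (MeasurableEquiv.measurableEmbedding _)]
    refine lintegral_congr fun y => ?_
    have hy : (MeasurableEquiv.piCongrLeft (fun _ : ι => X) e.symm) y = y ∘ e := by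
      funext i
      simp [MeasurableEquiv.coe_piCongrLeft, Equiv.piCongrLeft_apply]
    rw [hy, addPoints_comp_equiv]
    simp only [Function.comp_apply]

end IsPoissonProbability

/-! ### Products of sums and partitions -/

theorem ENNReal.prod_tsum_eq_tsum_prod {ι C : Type*} [Fintype ι] (u : ι → C → ℝ≥0∞) :
    ∏ i, ∑' x, u i x = ∑' φ : ι → C, ∏ i, u i (φ i) := by
  refine Fintype.induction_empty_option (P := fun ι _ => ∀ u : ι → C → ℝ≥0∞,
    ∏ i, ∑' x, u i x = ∑' φ : ι → C, ∏ i, u i (φ i)) ?_ ?_ ?_ ι u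
  · intro ι κ _ e ih u
    let _ := Fintype.ofEquiv κ e.symm
    rw [← e.prod_comp, ih, ← (e.arrowCongr (Equiv.refl C)).symm.tsum_eq]
    refine tsum_congr fun φ => ?_
    rw [← e.prod_comp]
    rfl
  · intro u
    simp
  · intro ι _ ih u
    rw [Fintype.prod_option, ih, ← Equiv.piOptionEquivProd.symm.tsum_eq, ENNReal.tsum_prod',
      ← ENNReal.tsum_mul_right]
    refine tsum_congr fun x => ?_
    rw [← ENNReal.tsum_mul_left]
    refine tsum_congr fun φ => ?_
    rw [Fintype.prod_option]
    rfl

namespace Finpartition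

variable {α : Type*} [DecidableEq α] {S : Finset α} {C : Type*}

theorem ext_part {Q R : Finpartition S} (h : ∀ a ∈ S, ∀ b ∈ S, a ∈ Q.part b ↔ a ∈ R.part b) :
    Q = R := by
  have hpart : ∀ b ∈ S, Q.part b = R.part b := by
    intro b hb
    ext a
    by_cases ha : a ∈ S
    · exact h a ha b hb
    · exact iff_of_false (fun h => ha (Q.part_subset b h)) fun h => ha (R.part_subset b h)
  have hsub : ∀ Q R : Finpartition S, (∀ b ∈ S, Q.part b = R.part b) → Q.parts ⊆ R.parts := by
    intro Q R h B hB
    obtain ⟨b, hb⟩ := Q.nonempty_of_mem_parts hB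
    have hbS := Q.subset hB hb
    rw [← Q.part_eq_of_mem hB hb, h b hbS]
    exact R.part_mem.2 hbS
  exact Finpartition.ext ((hsub Q R hpart).antisymm (hsub R Q fun b hb => (hpart b hb).symm))

/-- The function on `S` which takes the value `y B` on each block `B` of the partition. -/
def blockwise (p : Σ Q : Finpartition S, (Q.parts ↪ C)) (d : S) : C :=
  p.2 ⟨p.1.part d, p.1.part_mem.2 d.2⟩

/-- A function on `S` is given by the partition into its nonempty fibres and by its values on these
fibres, which are distinct. -/
theorem bijective_blockwise :
    Function.Bijective (blockwise : (Σ Q : Finpartition S, (Q.parts ↪ C)) → S → C) := by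
  constructor
  · rintro ⟨Q, y⟩ ⟨R, z⟩ h
    have key : ∀ (p : Σ Q : Finpartition S, (Q.parts ↪ C)) (a b : S),
        (a : α) ∈ p.1.part b ↔ blockwise p a = blockwise p b := by
      intro p a b
      rw [p.1.mem_part_iff_part_eq_part a.2 b.2, blockwise, blockwise, p.2.injective.eq_iff,
        Subtype.mk.injEq]
    have hQR : Q = R := ext_part fun a ha b hb => by
      have h1 := key ⟨Q, y⟩ ⟨a, ha⟩ ⟨b, hb⟩
      rw [h] at h1
      exact h1.trans (key ⟨R, z⟩ ⟨a, ha⟩ ⟨b, hb⟩).symm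
    subst hQR
    congr 1
    ext ⟨B, hB⟩
    obtain ⟨b, hb⟩ := Q.nonempty_of_mem_parts hB
    have h1 := congrFun h ⟨b, Q.subset hB hb⟩
    simpa only [blockwise, Q.part_eq_of_mem hB hb] using h1
  · classical
    intro φ
    -- the partition is induced by the kernel of an extension of `φ` to all of `α`
    let φ' : α → Option C := fun a => if h : a ∈ S then some (φ ⟨a, h⟩) else none
    let Q : Finpartition S := Finpartition.ofSetSetoid (Setoid.ker φ') S
    have hQ : ∀ a b : S, (a : α) ∈ Q.part b ↔ φ a = φ b := by
      intro a b
      rw [mem_part_ofSetSetoid_iff_rel]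
      simp [φ', Setoid.ker_def, eq_comm]
    have hr : ∀ B : Q.parts, ∃ d : S, (d : α) ∈ (B : Finset α) := fun B => by
      obtain ⟨b, hb⟩ := Q.nonempty_of_mem_parts B.2
      exact ⟨⟨b, Q.subset B.2 hb⟩, hb⟩
    choose r hr using hr
    refine ⟨⟨Q, fun B => φ (r B), ?_⟩, ?_⟩
    · intro B B' h
      have h1 := (hQ _ _).2 h
      rw [Q.part_eq_of_mem B'.2 (hr B')] at h1
      exact Subtype.ext (Q.eq_of_mem_parts B.2 B'.2 (hr B) h1)
    · funext d
      exact (hQ _ _).1 (hr ⟨Q.part d, Q.part_mem.2 d.2⟩)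

theorem prod_univ_part {M : Type*} [CommMonoid M] (Q : Finpartition S) (v : α → Q.parts → M) :
    ∏ d : S, v d ⟨Q.part d, Q.part_mem.2 d.2⟩ = ∏ B : Q.parts, ∏ d ∈ (B : Finset α), v d B := by
  refine (Fintype.prod_equiv Q.equivSigmaParts _
    (fun p : Σ B : Q.parts, (B : Finset α) => v p.2 p.1) fun d => rfl).trans ?_
  rw [Fintype.prod_sigma]
  refine Finset.prod_congr rfl fun B _ => ?_
  exact Finset.prod_coe_sort (B : Finset α) fun d => v d B

/-- A product of sums is expanded into a sum over all choices of one index for each factor, and the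
choices are sorted by the partition which records the factors with equal indices. -/
theorem prod_tsum_eq_sum_tsum_embedding (u : α → C → ℝ≥0∞) :
    ∏ d ∈ S, ∑' x, u d x =
      ∑ Q : Finpartition S, ∑' y : Q.parts ↪ C, ∏ B : Q.parts, ∏ d ∈ (B : Finset α), u d (y B) := by
  rw [← Finset.prod_coe_sort, ENNReal.prod_tsum_eq_tsum_prod fun (d : S) x => u d x,
    ← (Equiv.ofBijective _ (bijective_blockwise (S := S) (C := C))).tsum_eq, ENNReal.tsum_sigma',
    tsum_fintype]
  refine Finset.sum_congr rfl fun Q _ => tsum_congr fun y => ?_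
  exact Q.prod_univ_part fun d B => u d (y B)

end Finpartition

/-! ### The numbering of the factors -/

section BlockPart

variable {l : ℕ} (n : Fin l → ℕ)

theorem sum_Iic_eq_sum_Iio_add (j : Fin l) :
    ∑ m ∈ Finset.Iic j, n m = ∑ m ∈ Finset.Iio j, n m + n j := by
  rw [← Finset.Iio_insert, Finset.sum_insert (by simp), add_comm]

/-- The intervals that define the block parts tile `{1, …, ∑ j, n j}`. -/
theorem existsUnique_sum_Iio_lt_le_sum_Iic {d : ℕ} (hd : d ∈ Finset.Icc 1 (∑ j, n j)) :
    ∃! j, ∑ m ∈ Finset.Iio j, n m < d ∧ d ≤ ∑ m ∈ Finset.Iic j, n m := by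
  rw [Finset.mem_Icc] at hd
  have hl : l ≠ 0 := by
    rintro rfl
    simp at hd
    omega
  obtain ⟨l, rfl⟩ : ∃ k, l = k + 1 := Nat.exists_eq_succ_of_ne_zero hl
  have hne : (Finset.univ.filter fun j => d ≤ ∑ m ∈ Finset.Iic j, n m).Nonempty := by
    refine ⟨Fin.last l, ?_⟩
    have : Finset.Iic (Fin.last l) = Finset.univ := by
      ext j
      simp [Fin.le_last]
    simpa [this] using hd.2
  refine existsUnique_of_exists_of_unique ?_ ?_
  · refine ⟨Finset.min' _ hne, ?_, (Finset.mem_filter.1 (Finset.min'_mem _ hne)).2⟩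
    by_contra! hlt
    generalize hj : Finset.min' _ hne = j at hlt
    induction j using Fin.cases with
    | zero =>
      have h0 : Finset.Iio (0 : Fin (l + 1)) = ∅ := by
        ext m
        simp
      rw [h0, Finset.sum_empty] at hlt
      omega
    | succ i =>
      have h1 : Finset.Iio i.succ = Finset.Iic i.castSucc := by
        ext m
        simp [Fin.lt_def, Fin.le_def]
      rw [h1] at hlt
      have h2 := Finset.min'_le (Finset.univ.filter fun j => d ≤ ∑ m ∈ Finset.Iic j, n m) i.castSucc
        (Finset.mem_filter.2 ⟨Finset.mem_univ _, hlt⟩)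
      rw [hj] at h2
      simp [Fin.le_def] at h2
  · have key : ∀ i j : Fin (l + 1), i < j → d ≤ ∑ m ∈ Finset.Iic i, n m →
        ¬ ∑ m ∈ Finset.Iio j, n m < d := by
      intro i j hij hi hj
      have : ∑ m ∈ Finset.Iic i, n m ≤ ∑ m ∈ Finset.Iio j, n m :=
        Finset.sum_le_sum_of_subset fun m hm =>
          Finset.mem_Iio.2 ((Finset.mem_Iic.1 hm).trans_lt hij)
      omega
    intro i j hi hj
    rcases lt_trichotomy i j with h | h | h
    · exact (key i j h hi.2 hj.1).elim
    · exact h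
    · exact (key j i h hj.2 hi.1).elim

theorem card_blockPart_Icc (j : Fin l) :
    (blockPart n (Finset.Icc 1 (∑ j, n j)) j).card = n j := by
  have h : blockPart n (Finset.Icc 1 (∑ j, n j)) j =
      Finset.Ioc (∑ m ∈ Finset.Iio j, n m) (∑ m ∈ Finset.Iic j, n m) := by
    have hle : ∑ m ∈ Finset.Iic j, n m ≤ ∑ m, n m :=
      Finset.sum_le_sum_of_subset (Finset.subset_univ _)
    ext d
    simp only [blockPart, Finset.mem_filter, Finset.mem_Icc, Finset.mem_Ioc]
    omega
  rw [h, Nat.card_Ioc, sum_Iic_eq_sum_Iio_add, Nat.add_sub_cancel_left]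

/-- The factors of `∏ j, a j ^ n j` are numbered by `1, …, ∑ j, n j`; here `c d` is the index of the
base of the factor with number `d`. -/
theorem exists_blockPart_eq_filter [Nonempty (Fin l)] :
    ∃ c : ℕ → Fin l, ∀ B ⊆ Finset.Icc 1 (∑ j, n j), ∀ j,
      blockPart n B j = B.filter fun d => c d = j := by
  choose! c hc hc' using fun d (hd : d ∈ Finset.Icc 1 (∑ j, n j)) =>
    existsUnique_sum_Iio_lt_le_sum_Iic n hd
  refine ⟨c, fun B hB j => Finset.filter_congr fun d hd => ⟨fun h => ?_, ?_⟩⟩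
  · exact (hc' d (hB hd) j h).symm
  · rintro rfl
    exact hc d (hB hd)

theorem prod_pow_card_blockPart {M : Type*} [CommMonoid M] {c : ℕ → Fin l} {B : Finset ℕ}
    (h : ∀ j, blockPart n B j = B.filter fun d => c d = j) (a : Fin l → M) :
    ∏ j, a j ^ (blockPart n B j).card = ∏ d ∈ B, a (c d) := by
  rw [← Finset.prod_fiberwise' B c a]
  refine Finset.prod_congr rfl fun j _ => ?_
  rw [h j, Finset.prod_const]

end BlockPart

/-! ### The moment formula -/

/-- The points `y_1, …, y_k` of `X ^ k` are indexed by the `k` blocks of the partition. -/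
theorem mainTheorem5 {X : Type*} [MetricSpace X] [LocallyCompactSpace X]
    [TopologicalSpace.SeparableSpace X] [MeasurableSpace X] [BorelSpace X]
    (σ : Measure X) [SigmaFinite σ] [NullSingletonClass σ]
    (P : Measure (Configuration X)) (hP : IsPoissonProbability σ P)
    (l : ℕ) (hl : 1 ≤ l) (n : Fin l → ℕ) (hn : ∀ j, 1 ≤ n j)
    (f₀ : Configuration X → ℝ) (hf₀_meas : Measurable f₀) (hf₀_nonneg : ∀ ω, 0 ≤ f₀ ω)
    (f : Fin l → X → Configuration X → ℝ)
    (hf_meas : ∀ j, Measurable fun p : X × Configuration X => f j p.1 p.2)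
    (hf_nonneg : ∀ j x ω, 0 ≤ f j x ω) :
    ∫⁻ ω, ENNReal.ofReal (f₀ ω) *
        ∏ j, (∫⁻ x, ENNReal.ofReal (f j x ω) ∂ω.toMeasure) ^ n j ∂P =
      ∑ 𝒬 : Finpartition (Finset.Icc 1 (∑ j, n j)),
        ∫⁻ ω, ∫⁻ y : 𝒬.parts → X,
          ENNReal.ofReal (f₀ (ω.addPoints y) *
            ∏ B : 𝒬.parts, ∏ j,
              f j (y B) (ω.addPoints y) ^ (blockPart n (B : Finset ℕ) j).card)
          ∂(Measure.pi fun _ => σ) ∂P := by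
  have : SecondCountableTopology X := UniformSpace.secondCountable_of_separable X
  have : Nonempty (Fin l) := ⟨⟨0, hl⟩⟩
  obtain ⟨c, hc⟩ := exists_blockPart_eq_filter n
  let h : ∀ 𝒬 : Finpartition (Finset.Icc 1 (∑ j, n j)),
      Configuration X × (𝒬.parts → X) → ℝ≥0∞ := fun 𝒬 p =>
    ENNReal.ofReal (f₀ p.1 *
      ∏ B : 𝒬.parts, ∏ j, f j (p.2 B) p.1 ^ (blockPart n (B : Finset ℕ) j).card)
  have hh : ∀ 𝒬, Measurable (h 𝒬) := fun 𝒬 => by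
    refine ENNReal.measurable_ofReal.comp ((hf₀_meas.comp measurable_fst).mul ?_)
    refine Finset.measurable_prod _ fun B _ => Finset.measurable_prod _ fun j _ => ?_
    have hB : Measurable fun p : Configuration X × (𝒬.parts → X) => (p.2 B, p.1) := by fun_prop
    exact ((hf_meas j).comp hB).pow_const _
  have hh' : ∀ 𝒬 p, h 𝒬 p = ENNReal.ofReal (f₀ p.1) * ∏ B : 𝒬.parts,
      ∏ d ∈ (B : Finset ℕ), ENNReal.ofReal (f (c d) (p.2 B) p.1) := by
    intro 𝒬 p
    simp only [h]
    rw [ENNReal.ofReal_mul (hf₀_nonneg _), ENNReal.ofReal_prod_of_nonneg fun B _ =>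
      Finset.prod_nonneg fun j _ => pow_nonneg (hf_nonneg _ _ _) _]
    congr 1
    refine Finset.prod_congr rfl fun B _ => ?_
    rw [prod_pow_card_blockPart n (hc B (𝒬.le B.2)) fun j => f j (p.2 B) p.1,
      ENNReal.ofReal_prod_of_nonneg fun d _ => hf_nonneg _ _ _]
  have hω : ∀ ω : Configuration X, ENNReal.ofReal (f₀ ω) *
      ∏ j, (∫⁻ x, ENNReal.ofReal (f j x ω) ∂ω.toMeasure) ^ n j =
      ∑ 𝒬 : Finpartition (Finset.Icc 1 (∑ j, n j)),
        ∑' y : 𝒬.parts ↪ ω.carrier, h 𝒬 (ω, fun B => y B) := by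
    intro ω
    have h1 := prod_pow_card_blockPart n (hc _ subset_rfl) fun j =>
      ∫⁻ x, ENNReal.ofReal (f j x ω) ∂ω.toMeasure
    simp only [card_blockPart_Icc] at h1
    simp only [hh', ENNReal.tsum_mul_left, ← Finset.mul_sum]
    rw [h1]
    simp only [Configuration.lintegral_toMeasure]
    rw [Finpartition.prod_tsum_eq_sum_tsum_embedding fun d (x : ω.carrier) =>
      ENNReal.ofReal (f (c d) x ω)]
  simp_rw [hω]
  rw [lintegral_finsetSum _ fun 𝒬 _ => Configuration.measurable_tsum_embedding (hh 𝒬)]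
  exact Finset.sum_congr rfl fun 𝒬 _ => hP.lintegral_tsum_embedding (hh 𝒬)
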